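/- **Theorem (generalized Young integral).** Let $\mathcal V_1,\mathcal V_2$ be Banach spaces (over the same field $\mathbb R$ or $\mathbb C$), and let $\mathcal V_1\otimes\mathcal V_2$ denote the completion of the algebraic tensor product with respect to a norm satisfying $\|v\otimes u\|\le\|v\|\,\|u\|$. Let $\gamma_i:[0,1]\to\mathcal V_i$, $i=1,2$, be continuous paths. Suppose there exist $p>1$, $q>1$ with $p^{-1}+q^{-1}=1$, and non-decreasing functions $m_i:[0,1]\to[0,\infty)$, $i=1,2$, with $$\lim_{t\to0+}m_i(t)=0,\qquad m_i(1)\le1,\qquad L:=\int_0^1\frac{m_1(t)\,m_2(t)}{t}\,dt<\infty,$$ such that $$C_1:=\sup_{0\le s<t\le1}\frac{\|\gamma_1(t)-\gamma_1(s)\|}{|t-s|^{1/p}\,m_1(t-s)}<\infty,\qquad C_2:=\sup_{0\le s<t\le1}\frac{\|\gamma_2(t)-\gamma_2(s)\|}{|t-s|^{1/q}\,m_2(t-s)}<\infty$$ (with $0/0=0$ and $c/0=\infty$ for $c>0$). For $0\le s\le t\le 1$ the Riemann–Stieltjes integral $\int_s^t f\otimes d\gamma_2$ is the limit, as the mesh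 of the finite partition $s=t_0<\dots<t_n=t$ tends to $0$, of the sums $\sum_j f(\xi_j)\otimes(\gamma_2(t_{j+1})-\gamma_2(t_j))$ with arbitrary $\xi_j\in[t_j,t_{j+1}]$. For $r\geq 1$ the $r$-variation of a function $\alpha(s,t)$, $0\le s\le t\le1$, is $\|\alpha\|_{r\text{-}var}=\big(\sup\sum_j\|\alpha(t_j,t_{j+1})\|^r\big)^{1/r}$, the supremum being over all finite partitions $0=t_0<\dots<t_n=1$, and that of a path $\gamma$ is the $r$-variation of $(s,t)\mapsto\gamma(t)-\gamma(s)$. Then: 1. For every $t\in[0,1]$ the Riemann–Stieltjes integral $\int_0^t\gamma_1(u)\otimes d\gamma_2(u)$ exists; it is continuous in $t$, and $$\Big\|\int_0^{\cdot}\gamma_1\otimes d\gamma_2\Big\|_{q\text{-}var}\le 8C_1C_2(2+L)+\|\gamma_1(0)\|\,C_2 .$$ In particular, if $\gamma_1(0)=0$, then $$\Big\|\int_0^{\cdot}\gamma_1\otimes d\gamma_2\Big\|_{q\text{-}var}\le 8C_1C_2\Big(2+\int_0^1\frac{m_1(t)m_2(t)}{t}\,dt\Big).$$ 2. For all $0\le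 s\le t\le1$ the iterated Riemann–Stieltjes integral $$I(\gamma_1,\gamma_2)(s,t)=\iint_{s<u_1<u_2<t}d\gamma_1(u_1)\otimes d\gamma_2(u_2)=\int_s^t(\gamma_1(u)-\gamma_1(s))\otimes d\gamma_2(u)$$ exists; it is continuous in $(s,t)$, and $$\|I(\gamma_1,\gamma_2)\|_{1\text{-}var}\le C_1C_2\Big(15+8\int_0^1\frac{m_1(t)m_2(t)}{t}\,dt\Big).$$ -/

import Mathlib

open Set Filter Topology MeasureTheory
open scoped TensorProduct ENNReal

noncomputable section

/-! ### Completed tensor products -/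

/-- A norm on the algebraic tensor product `V ⊗ U` of two normed spaces which satisfies
`‖v ⊗ u‖ ≤ ‖v‖ ‖u‖`. -/
structure TensorNorm (𝕜 V U : Type*) [RCLike 𝕜] [NormedAddCommGroup V] [NormedSpace 𝕜 V]
    [NormedAddCommGroup U] [NormedSpace 𝕜 U] extends Seminorm 𝕜 (V ⊗[𝕜] U) where
  eq_zero_of_eq_zero' : ∀ x : V ⊗[𝕜] U, toFun x = 0 → x = 0
  tmul_le' : ∀ (v : V) (u : U), toFun (v ⊗ₜ[𝕜] u) ≤ ‖v‖ * ‖u‖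

section Tensor

variable {𝕜 V U : Type*} [RCLike 𝕜] [NormedAddCommGroup V] [NormedSpace 𝕜 V]
  [NormedAddCommGroup U] [NormedSpace 𝕜 U]

/-- The algebraic tensor product `V ⊗ U`, to be equipped with the norm `N`. -/
def NormedTensor (_N : TensorNorm 𝕜 V U) : Type _ := V ⊗[𝕜] U

instance (N : TensorNorm 𝕜 V U) : AddCommGroup (NormedTensor N) :=
  inferInstanceAs (AddCommGroup (V ⊗[𝕜] U))

instance (N : TensorNorm 𝕜 V U) : Module 𝕜 (NormedTensor N) :=
  inferInstanceAs (Module 𝕜 (V ⊗[𝕜] U))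

/-- `N` as a norm of the additive group `V ⊗ U`. -/
def TensorNorm.groupNorm (N : TensorNorm 𝕜 V U) : AddGroupNorm (NormedTensor N) where
  toFun x := N.toSeminorm x
  map_zero' := map_zero N.toSeminorm
  add_le' := map_add_le_add N.toSeminorm
  neg' := map_neg_eq_map N.toSeminorm
  eq_zero_of_map_eq_zero' := N.eq_zero_of_eq_zero'

instance (N : TensorNorm 𝕜 V U) : NormedAddCommGroup (NormedTensor N) :=
  { N.groupNorm.toNormedAddCommGroup with }

instance (N : TensorNorm 𝕜 V U) : NormedSpace 𝕜 (NormedTensor N) where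
  norm_smul_le c x := (map_smul_eq_mul N.toSeminorm c x).le

/-- The Banach space obtained by completing `V ⊗ U` with respect to the norm `N`. -/
abbrev CompletedTensor (N : TensorNorm 𝕜 V U) : Type _ :=
  UniformSpace.Completion (NormedTensor N)

/-- The elementary tensor `v ⊗ u` in the completed tensor product. -/
def TensorNorm.tmul (N : TensorNorm 𝕜 V U) (v : V) (u : U) : CompletedTensor N :=
  UniformSpace.Completion.coe' (show NormedTensor N from v ⊗ₜ[𝕜] u)

end Tensor

/-! ### Finite partitions and `p`-variation -/

/-- A finite partition `a = t₀ < t₁ < ⋯ < tₙ = b` of `[a, b]`; only the values `pts i` with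
`i ≤ n` are relevant. -/
structure FinitePartition (a b : ℝ) where
  n : ℕ
  pts : ℕ → ℝ
  pts_lt : ∀ i < n, pts i < pts (i + 1)
  pts_zero : pts 0 = a
  pts_last : pts n = b

/-- The mesh of the partition is at most `δ`. -/
def FinitePartition.MeshLE {a b : ℝ} (D : FinitePartition a b) (δ : ℝ) : Prop :=
  ∀ i < D.n, D.pts (i + 1) - D.pts i ≤ δ

/-- The `p`-variation on `[a, b]` of a function `α` of pairs `s ≤ t`, with value `∞` if it is
not finite. -/
def pVariation {E : Type*} [NormedAddCommGroup E] (p : ℝ) (α : ℝ → ℝ → E) (a b : ℝ) : ℝ≥0∞ :=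
  (⨆ D : FinitePartition a b,
    ∑ i ∈ Finset.range D.n, ‖α (D.pts i) (D.pts (i + 1))‖ₑ ^ p) ^ (1 / p)

/-- The `p`-variation on `[a, b]` of a path. -/
def pathPVariation {E : Type*} [NormedAddCommGroup E] (p : ℝ) (γ : ℝ → E) (a b : ℝ) : ℝ≥0∞ :=
  pVariation p (fun s t => γ t - γ s) a b

/-- The supremum over `0 ≤ s < t ≤ 1` of `‖γ t - γ s‖ / ((t - s) ^ r * m (t - s))`, in `[0, ∞]`,
with the conventions `0 / 0 = 0` and `c / 0 = ∞` for `c > 0`. -/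
def modulusConst {E : Type*} [NormedAddCommGroup E] (γ : ℝ → E) (r : ℝ) (m : ℝ → ℝ) : ℝ≥0∞ :=
  ⨆ (s : ℝ) (t : ℝ) (_ : 0 ≤ s ∧ s < t ∧ t ≤ 1),
    ‖γ t - γ s‖ₑ / ENNReal.ofReal ((t - s) ^ r * m (t - s))

/-! ### The Riemann–Stieltjes integral -/

section RiemannStieltjes

variable {𝕜 V U : Type*} [RCLike 𝕜] [NormedAddCommGroup V] [NormedSpace 𝕜 V]
  [NormedAddCommGroup U] [NormedSpace 𝕜 U]

/-- The Riemann sum `∑ f (ξᵢ) ⊗ (g (tᵢ₊₁) - g (tᵢ))`. -/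
def riemannSum (N : TensorNorm 𝕜 V U) (f : ℝ → V) (g : ℝ → U) {a b : ℝ}
    (D : FinitePartition a b) (ξ : ℕ → ℝ) : CompletedTensor N :=
  ∑ i ∈ Finset.range D.n, N.tmul (f (ξ i)) (g (D.pts (i + 1)) - g (D.pts i))

/-- `J` is the Riemann–Stieltjes integral `∫ₐᵇ f ⊗ dg`: the limit of the Riemann sums, with
arbitrary representative points, as the mesh of the partition tends to zero. -/
def HasRSIntegral (N : TensorNorm 𝕜 V U) (f : ℝ → V) (g : ℝ → U) (a b : ℝ)
    (J : CompletedTensor N) : Prop :=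
  ∀ ε > 0, ∃ δ > 0, ∀ D : FinitePartition a b, D.MeshLE δ →
    ∀ ξ : ℕ → ℝ, (∀ i < D.n, ξ i ∈ Icc (D.pts i) (D.pts (i + 1))) →
      ‖riemannSum N f g D ξ - J‖ < ε

/-- The Riemann–Stieltjes integral `∫ₐᵇ f ⊗ dg` exists. -/
def RSIntegrable (N : TensorNorm 𝕜 V U) (f : ℝ → V) (g : ℝ → U) (a b : ℝ) : Prop :=
  ∃ J : CompletedTensor N, HasRSIntegral N f g a b J

open Classical in
/-- The Riemann–Stieltjes integral `∫ₐᵇ f ⊗ dg` (zero if it does not exist). -/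
def rsIntegral (N : TensorNorm 𝕜 V U) (f : ℝ → V) (g : ℝ → U) (a b : ℝ) : CompletedTensor N :=
  if h : RSIntegrable N f g a b then h.choose else 0

/-- The iterated integral
`I(γ₁, γ₂)(s, t) = ∬_{s < u₁ < u₂ < t} dγ₁(u₁) ⊗ dγ₂(u₂) = ∫ₛᵗ (γ₁(u) - γ₁(s)) ⊗ dγ₂(u)`. -/
def iteratedRSIntegral (N : TensorNorm 𝕜 V U) (γ₁ : ℝ → V) (γ₂ : ℝ → U) (s t : ℝ) :
    CompletedTensor N :=
  rsIntegral N (fun u => γ₁ u - γ₁ s) γ₂ s t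

end RiemannStieltjes

end

/-!
Write `w₁, w₂` for the moduli of continuity `C₁ h^(1/p) m₁(h)` and `C₂ h^(1/q) m₂(h)`, so that
`w₁(h) w₂(h) = C₁ C₂ h m₁(h) m₂(h)`, and `Λ(T) = C₁ C₂ ∫₀ᵀ m₁(t) m₂(t) / t dt`.

The local estimate is Young's. In a partition of an interval of length `T` into `n` intervals,
some interior point has neighbours at distance at most `h = 2T / (n - 1)`; removing it changes the
left Riemann sum of `γ₁ - γ₁(s)` by at most `w₁(h) w₂(h)`. Removing all interior points one by one
and comparing the resulting sum with the integral `Λ` gives the bound `2 w₁(T) w₂(T) + 2 T Λ(T)`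
for every left Riemann sum (`norm_leftSum_le`). Hence the order of magnitude is `T`, with a factor
that tends to zero with `T`.

The indefinite integral `J` is the limit of left sums over the dyadic partitions of `[0, 1]`, with
the integrator stopped at `t`. Successive dyadic sums differ by at most
`Λ(2⁻ⁿ) - Λ(2⁻ⁿ⁻¹)`, which is summable. Because the same dyadic grid serves all `t`, increments of
`J` add up without any common refinement of partitions, and
`J t - J s - γ₁(s) ⊗ (γ₂(t) - γ₂(s))` inherits the local estimate (`exists_indefinite_integral`).
Summing that estimate over a fine partition shows that all tagged Riemann sums converge to
increments of `J` (`hasRSIntegral_of_increments`).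

The iterated integral is `I(s, t) = J t - J s - γ₁(s) ⊗ (γ₂(t) - γ₂(s))`, so the local estimate
gives `‖I(s, t)‖ ≤ C₁ C₂ (2 + 2 L) (t - s)` and
`‖J t - J s‖ ≤ (C₁ C₂ (3 + 2 L) + ‖γ₁(0)‖ C₂) (t - s)^(1/q)`. These pointwise bounds imply
continuity and, summed over a partition, the bounds on the variations.
-/

open Set Filter Topology MeasureTheory
open scoped TensorProduct ENNReal

/-! ### Left Riemann sums along sequences -/

section LeftSums

variable {𝕜 V U E : Type*} [RCLike 𝕜] [NormedAddCommGroup V] [NormedSpace 𝕜 V]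
  [NormedAddCommGroup U] [NormedSpace 𝕜 U] [NormedAddCommGroup E] [NormedSpace 𝕜 E]

/-- The sum `∑_{i < n} B (f i) (g (i + 1) - g i)` for a bilinear map `B`. -/
noncomputable def leftSum (B : V →L[𝕜] U →L[𝕜] E) (f : ℕ → V) (g : ℕ → U) (n : ℕ) : E :=
  ∑ i ∈ Finset.range n, B (f i) (g (i + 1) - g i)

/-- The increasing enumeration of `ℕ \ {j + 1}`. -/
def skipSucc (j i : ℕ) : ℕ := if i ≤ j then i else i + 1

theorem skipSucc_of_le {j i : ℕ} (h : i ≤ j) : skipSucc j i = i := if_pos h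

theorem skipSucc_of_lt {j i : ℕ} (h : j < i) : skipSucc j i = i + 1 := if_neg (by omega)

theorem monotone_skipSucc (j : ℕ) : Monotone (skipSucc j) := by
  intro a b h
  unfold skipSucc
  split_ifs <;> omega

variable (B : V →L[𝕜] U →L[𝕜] E)

theorem leftSum_succ (f : ℕ → V) (g : ℕ → U) (n : ℕ) :
    leftSum B f g (n + 1) = leftSum B f g n + B (f n) (g (n + 1) - g n) :=
  Finset.sum_range_succ _ _

theorem leftSum_const (v : V) (g : ℕ → U) (n : ℕ) :
    leftSum B (fun _ => v) g n = B v (g n - g 0) := by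
  rw [leftSum, ← map_sum, Finset.sum_range_sub]

theorem leftSum_sub (f f' : ℕ → V) (g : ℕ → U) (n : ℕ) :
    leftSum B (fun i => f i - f' i) g n = leftSum B f g n - leftSum B f' g n := by
  simp [leftSum, Finset.sum_sub_distrib]

/-- Effect on a left sum of removing the partition point with index `j + 1`. -/
theorem leftSum_sub_leftSum_skipSucc (f : ℕ → V) (g : ℕ → U) (j d : ℕ) :
    leftSum B f g (j + 2 + d) - leftSum B (f ∘ skipSucc j) (g ∘ skipSucc j) (j + 1 + d) =
      B (f (j + 1) - f j) (g (j + 2) - g (j + 1)) := by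
  induction d with
  | zero =>
    have h : leftSum B (f ∘ skipSucc j) (g ∘ skipSucc j) j = leftSum B f g j := by
      refine Finset.sum_congr rfl fun i hi => ?_
      have hi := Finset.mem_range.1 hi
      simp only [Function.comp_apply, skipSucc_of_le hi.le,
        skipSucc_of_le (Nat.succ_le_of_lt hi)]
    simp only [add_zero, leftSum_succ, h, Function.comp_apply, skipSucc_of_le le_rfl,
      skipSucc_of_lt (Nat.lt_succ_self j), map_sub, sub_apply]
    abel
  | succ d ih =>
    rw [← ih, ← add_assoc, ← add_assoc, leftSum_succ, leftSum_succ]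
    simp only [Function.comp_apply, skipSucc_of_lt (show j < j + 1 + d by omega),
      skipSucc_of_lt (show j < j + 1 + d + 1 by omega),
      show j + 2 + d = j + 1 + d + 1 by omega]
    abel

theorem leftSum_two_mul_sub (f : ℕ → V) (g : ℕ → U) (n : ℕ) :
    leftSum B f g (2 * n) - leftSum B (fun k => f (2 * k)) (fun k => g (2 * k)) n =
      ∑ k ∈ Finset.range n,
        B (f (2 * k + 1) - f (2 * k)) (g (2 * k + 2) - g (2 * k + 1)) := by
  induction n with
  | zero => simp [leftSum]
  | succ n ih =>
    rw [Finset.sum_range_succ, ← ih, show 2 * (n + 1) = 2 * n + 1 + 1 by ring, leftSum_succ,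
      leftSum_succ, leftSum_succ]
    simp only [map_sub, sub_apply, show 2 * (n + 1) = 2 * n + 1 + 1 by ring]
    abel

end LeftSums

/-! ### Young's estimate -/

/-- `w` is a modulus of continuity of `γ` on `[0, 1]`. -/
def HasModulus {E : Type*} [NormedAddCommGroup E] (γ : ℝ → E) (w : ℝ → ℝ) : Prop :=
  ∀ s t, 0 ≤ s → s ≤ t → t ≤ 1 → ‖γ t - γ s‖ ≤ w (t - s)

/-- A pair of moduli `w₁, w₂` together with a function `Λ` which plays the role of
`h ↦ ∫₀ʰ w₁(u) w₂(u) / u² du`. The field `step` is all that is used of this integral: it bounds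
the integral over `[a, b]` from below when `w₁(u) w₂(u) / u` is non-decreasing. -/
structure YoungControl (w₁ w₂ Λ : ℝ → ℝ) : Prop where
  nonneg₁ : ∀ h ∈ Icc (0 : ℝ) 1, 0 ≤ w₁ h
  nonneg₂ : ∀ h ∈ Icc (0 : ℝ) 1, 0 ≤ w₂ h
  mono₁ : MonotoneOn w₁ (Icc 0 1)
  mono₂ : MonotoneOn w₂ (Icc 0 1)
  nonneg : ∀ h, 0 ≤ Λ h
  tendsto_zero : Tendsto Λ (𝓝[>] 0) (𝓝 0)
  step : ∀ a b, 0 < a → a ≤ b → b ≤ 1 → w₁ a * w₂ a * (b - a) ≤ a * b * (Λ b - Λ a)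

namespace YoungControl

variable {w₁ w₂ Λ : ℝ → ℝ} (W : YoungControl w₁ w₂ Λ)
include W

theorem mul_nonneg {h : ℝ} (hh : h ∈ Icc (0 : ℝ) 1) : 0 ≤ w₁ h * w₂ h :=
  _root_.mul_nonneg (W.nonneg₁ h hh) (W.nonneg₂ h hh)

theorem mono {a b : ℝ} (ha : 0 < a) (hab : a ≤ b) (hb : b ≤ 1) : Λ a ≤ Λ b := by
  have h := (_root_.mul_nonneg (W.mul_nonneg ⟨ha.le, hab.trans hb⟩) (sub_nonneg.2 hab)).trans
    (W.step a b ha hab hb)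
  have := nonneg_of_mul_nonneg_right h (mul_pos ha (ha.trans_le hab))
  linarith

/-- The product of the moduli is `o(a)` as `a → 0`, since `Λ` tends to zero. -/
theorem mul_le_of_two_mul_le {a : ℝ} (ha : 0 < a) (h : 2 * a ≤ 1) :
    w₁ a * w₂ a ≤ 2 * a * (Λ (2 * a) - Λ a) := by
  have := W.step a (2 * a) ha (by linarith) h
  refine le_of_mul_le_mul_right ?_ ha
  linarith

end YoungControl

section Young

variable {𝕜 V U E : Type*} [RCLike 𝕜] [NormedAddCommGroup V] [NormedSpace 𝕜 V]
  [NormedAddCommGroup U] [NormedSpace 𝕜 U] [NormedAddCommGroup E] [NormedSpace 𝕜 E]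
  {B : V →L[𝕜] U →L[𝕜] E} (hB : ∀ v u, ‖B v u‖ ≤ ‖v‖ * ‖u‖)
  {γ₁ : ℝ → V} {γ₂ : ℝ → U} {w₁ w₂ Λ : ℝ → ℝ} (W : YoungControl w₁ w₂ Λ)
  (h₁ : HasModulus γ₁ w₁) (h₂ : HasModulus γ₂ w₂)

include hB W h₁ h₂

theorem norm_bilin_increments_le {a a' b b' h : ℝ} (ha : 0 ≤ a) (haa : a ≤ a') (ha' : a' ≤ 1)
    (hb : 0 ≤ b) (hbb : b ≤ b') (hb' : b' ≤ 1) (hah : a' - a ≤ h) (hbh : b' - b ≤ h)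
    (hh : h ≤ 1) : ‖B (γ₁ a' - γ₁ a) (γ₂ b' - γ₂ b)‖ ≤ w₁ h * w₂ h := by
  have hm : h ∈ Icc (0 : ℝ) 1 := ⟨(sub_nonneg.2 haa).trans hah, hh⟩
  refine (hB _ _).trans (mul_le_mul ?_ ?_ (norm_nonneg _) (W.nonneg₁ h hm))
  · exact (h₁ a a' ha haa ha').trans (W.mono₁ ⟨by linarith, by linarith⟩ hm hah)
  · exact (h₂ b b' hb hbb hb').trans (W.mono₂ ⟨by linarith, by linarith⟩ hm hbh)

/-- Young's argument: some interior partition point has neighbours at distance at most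
`2 * T / (m + 2)`, where `T` is the length of the partitioned interval; remove it and induct.
The errors are bounded by the increments of `2 * T * Λ` between the successive distances, so that
their sum telescopes. -/
theorem norm_leftSum_le_of_pos (m : ℕ) (y : ℕ → ℝ) (hy : Monotone y)
    (hmem : ∀ i, y i ∈ Icc (0 : ℝ) 1) {T : ℝ} (hT : T = y (m + 3) - y 0) (hT0 : 0 < T) :
    ‖leftSum B (fun i => γ₁ (y i) - γ₁ (y 0)) (fun i => γ₂ (y i)) (m + 3)‖ ≤
      2 * (w₁ T * w₂ T) + 2 * T * (Λ T - Λ (2 * T / (m + 2))) := by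
  have hT1 : T ≤ 1 := by linarith [(hmem (m + 3)).2, (hmem 0).1]
  induction m generalizing y with
  | zero =>
    have e : 2 * T / ((0 : ℕ) + 2) = T := by push_cast; ring
    have key : ∀ i j k, i ≤ j → j ≤ 3 → k ≤ 3 → j ≤ k →
        ‖B (γ₁ (y j) - γ₁ (y i)) (γ₂ (y k) - γ₂ (y j))‖ ≤ w₁ T * w₂ T := by
      intro i j k hij hj hk hjk
      have := hy hij
      have := hy hj
      have := hy hk
      have := hy hjk
      have := hy (Nat.zero_le i)
      have := hy (Nat.zero_le j)
      simp only [zero_add] at hT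
      exact norm_bilin_increments_le hB W h₁ h₂ (hmem i).1 (hy hij) (hmem j).2 (hmem j).1
        (hy hjk) (hmem k).2 (by linarith) (by linarith) hT1
    have a1 := key 0 1 2 (by simp) (by simp) (by simp) (by simp)
    have a2 := key 0 2 3 (by simp) (by simp) (by simp) (by simp)
    rw [e, sub_self, mul_zero, add_zero, zero_add]
    simp only [leftSum, Finset.sum_range_succ, Finset.sum_range_zero, sub_self, map_zero,
      zero_apply, zero_add, Nat.reduceAdd]
    exact (norm_add_le _ _).trans (by linarith)
  | succ m ih =>
    set n : ℝ := (m : ℝ) + 2 with hn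
    have hn2 : 2 ≤ n := by rw [hn]; linarith [(Nat.cast_nonneg m : (0 : ℝ) ≤ m)]
    have hcast : ((m + 1 : ℕ) : ℝ) + 2 = n + 1 := by rw [hn]; push_cast; ring
    -- The distances `y (j + 2) - y j` add up to at most `2 * T`.
    obtain ⟨j, hj, hjle⟩ : ∃ j ∈ Finset.range (m + 3), y (j + 2) - y j ≤ 2 * T / (n + 1) := by
      refine Finset.exists_le_of_sum_le ⟨0, by simp⟩ ?_
      have e : ∀ j, y (j + 2) - y j = (y (j + 1 + 1) - y (j + 1)) + (y (j + 1) - y j) :=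
        fun j => by ring
      rw [Finset.sum_congr rfl fun j _ => e j, Finset.sum_add_distrib,
        Finset.sum_range_sub (fun j => y (j + 1)), Finset.sum_range_sub, Finset.sum_const,
        Finset.card_range, nsmul_eq_mul]
      have hc : ((m + 3 : ℕ) : ℝ) * (2 * T / (n + 1)) = 2 * T := by
        rw [hn]; push_cast; field_simp; ring
      rw [hc, hT]
      have := hy (show 0 ≤ 0 + 1 by simp)
      have := hy (show m + 3 ≤ m + 1 + 3 by omega)
      have : y (m + 3 + 1) = y (m + 1 + 3) := rfl
      linarith
    have hj := Finset.mem_range.1 hj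
    set h := 2 * T / (n + 1) with hh
    have hpos : 0 < h := by positivity
    have hb1 : 2 * T / n ≤ 1 := by rw [div_le_one (by linarith)]; linarith
    have hhb : h ≤ 2 * T / n := by
      rw [hh]; gcongr; linarith
    -- The factor `2 * T` comes from `1 / h - 1 / (2 * T / n) = 1 / (2 * T)`.
    have hstep : w₁ h * w₂ h ≤ 2 * T * (Λ (2 * T / n) - Λ h) := by
      have := W.step h (2 * T / n) hpos hhb hb1
      have e : 2 * T / n - h = h * (2 * T / n) / (2 * T) := by rw [hh]; field_simp; ring
      rw [e] at this
      have hp : 0 < h * (2 * T / n) / (2 * T) := by positivity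
      refine le_of_mul_le_mul_right (this.trans_eq ?_) hp
      field_simp
    have hrem : ‖B (γ₁ (y (j + 1)) - γ₁ (y j)) (γ₂ (y (j + 2)) - γ₂ (y (j + 1)))‖ ≤
        w₁ h * w₂ h := by
      have := hy (Nat.le_succ j)
      have := hy (Nat.le_succ (j + 1))
      refine norm_bilin_increments_le hB W h₁ h₂ (hmem _).1 (hy (Nat.le_succ j)) (hmem _).2
        (hmem _).1 (hy (Nat.le_succ (j + 1))) (hmem _).2 ?_ ?_ (hhb.trans hb1) <;>
      simp only [Nat.succ_eq_add_one, add_assoc, Nat.reduceAdd] at * <;> linarith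
    have hih := ih (y ∘ skipSucc j) (hy.comp (monotone_skipSucc j)) (fun i => hmem _)
      (by simp only [Function.comp_apply, skipSucc_of_lt hj, skipSucc_of_le (Nat.zero_le j)]
          exact hT)
    have hskip := leftSum_sub_leftSum_skipSucc B (fun i => γ₁ (y i) - γ₁ (y 0))
      (fun i => γ₂ (y i)) j (m + 2 - j)
    rw [show j + 2 + (m + 2 - j) = m + 1 + 3 by omega,
      show j + 1 + (m + 2 - j) = m + 3 by omega, sub_sub_sub_cancel_right,
      sub_eq_iff_eq_add] at hskip
    rw [hskip, hcast]
    have h0 : skipSucc j 0 = 0 := skipSucc_of_le (Nat.zero_le j)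
    simp only [Function.comp_apply, h0] at hih
    refine (norm_add_le _ _).trans ((add_le_add hrem hih).trans ?_)
    linarith

theorem norm_leftSum_le (n : ℕ) (y : ℕ → ℝ) (hy : Monotone y)
    (hmem : ∀ i, y i ∈ Icc (0 : ℝ) 1) :
    ‖leftSum B (fun i => γ₁ (y i) - γ₁ (y 0)) (fun i => γ₂ (y i)) n‖ ≤
      2 * (w₁ (y n - y 0) * w₂ (y n - y 0)) + 2 * (y n - y 0) * Λ (y n - y 0) := by
  have hT1 : y n - y 0 ≤ 1 := by linarith [(hmem n).2, (hmem 0).1]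
  rcases (sub_nonneg.2 (hy (Nat.zero_le n))).eq_or_lt with hT | hT
  · have hz : leftSum B (fun i => γ₁ (y i) - γ₁ (y 0)) (fun i => γ₂ (y i)) n = 0 := by
      refine Finset.sum_eq_zero fun i hi => ?_
      have e : y i = y 0 := le_antisymm
        ((hy (Finset.mem_range.1 hi).le).trans (by linarith)) (hy (Nat.zero_le i))
      simp [e]
    rw [hz, norm_zero, ← hT]
    have := W.mul_nonneg (h := 0) (by simp)
    linarith
  · -- The partition is extended by constants to have at least three intervals.
    have hmain := norm_leftSum_le_of_pos hB W h₁ h₂ n (fun i => y (min i n))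
      (fun a b hab => hy (min_le_min_right n hab)) (fun i => hmem _)
      (T := y n - y 0) (by simp) hT
    have e : leftSum B (fun i => γ₁ (y (min i n)) - γ₁ (y (min 0 n)))
        (fun i => γ₂ (y (min i n))) (n + 3) =
        leftSum B (fun i => γ₁ (y i) - γ₁ (y 0)) (fun i => γ₂ (y i)) n := by
      have : leftSum B (fun i => γ₁ (y (min i n)) - γ₁ (y (min 0 n)))
        (fun i => γ₂ (y (min i n))) n =
        leftSum B (fun i => γ₁ (y i) - γ₁ (y 0)) (fun i => γ₂ (y i)) n := by
        refine Finset.sum_congr rfl fun i hi => ?_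
        have hi := Finset.mem_range.1 hi
        simp [min_eq_left hi.le, min_eq_left (Nat.succ_le_of_lt hi)]
      rw [show n + 3 = n + 1 + 1 + 1 by rfl, leftSum_succ, leftSum_succ, leftSum_succ, this]
      simp [add_assoc]
    rw [e] at hmain
    refine hmain.trans ?_
    have := mul_nonneg hT.le (W.nonneg (2 * (y n - y 0) / (n + 2)))
    linarith

end Young

/-! ### The integral as a limit of dyadic sums -/

section Dyadic

variable {𝕜 V U E : Type*} [RCLike 𝕜] [NormedAddCommGroup V] [NormedSpace 𝕜 V]
  [NormedAddCommGroup U] [NormedSpace 𝕜 U] [NormedAddCommGroup E] [NormedSpace 𝕜 E]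

/-- The left Riemann sum of `∫₀ᵗ B (γ₁, dγ₂)` over the dyadic partition of `[0, 1]` of level `n`,
with the integrator stopped at `t`. The points at which `γ₁` is evaluated do not depend on `t`. -/
noncomputable def dyadicSum (B : V →L[𝕜] U →L[𝕜] E) (γ₁ : ℝ → V) (γ₂ : ℝ → U) (n : ℕ) (t : ℝ) : E :=
  leftSum B (fun k => γ₁ (k / 2 ^ n)) (fun k => γ₂ (min (k / 2 ^ n) t)) (2 ^ n)

/-- The left side bounds the difference of the dyadic sums of levels `n` and `n + 1`. -/
theorem YoungControl.mul_dyadic_le {w₁ w₂ Λ : ℝ → ℝ} (W : YoungControl w₁ w₂ Λ) (n : ℕ) :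
    2 ^ n * (w₁ (1 / 2 ^ (n + 1)) * w₂ (1 / 2 ^ (n + 1))) ≤
      Λ (1 / 2 ^ n) - Λ (1 / 2 ^ (n + 1)) := by
  have e : 2 * (1 / 2 ^ (n + 1) : ℝ) = 1 / 2 ^ n := by field_simp; ring
  have := W.mul_le_of_two_mul_le (a := 1 / 2 ^ (n + 1)) (by positivity)
    (by rw [e, div_le_one (by positivity)]; exact one_le_pow₀ one_le_two)
  rw [e] at this
  calc _ ≤ 2 ^ n * (1 / 2 ^ n * (Λ (1 / 2 ^ n) - Λ (1 / 2 ^ (n + 1)))) := by gcongr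
    _ = _ := by field_simp

theorem YoungControl.summable_dyadic {w₁ w₂ Λ : ℝ → ℝ} (W : YoungControl w₁ w₂ Λ) :
    Summable fun n : ℕ => Λ (1 / 2 ^ n) - Λ (1 / 2 ^ (n + 1)) := by
  refine summable_of_sum_range_le (c := Λ 1) (fun n => ?_) (fun n => ?_)
  · refine sub_nonneg.2 (W.mono (by positivity) ?_ ?_)
    · exact one_div_le_one_div_of_le (by positivity) (pow_le_pow_right₀ one_le_two n.le_succ)
    · rw [div_le_one (by positivity)]; exact one_le_pow₀ one_le_two
  · rw [Finset.sum_range_sub' (fun n : ℕ => Λ (1 / 2 ^ n))]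
    simpa using W.nonneg _

theorem YoungControl.tendsto_mul_dyadic {w₁ w₂ Λ : ℝ → ℝ} (W : YoungControl w₁ w₂ Λ) :
    Tendsto (fun n : ℕ => w₁ (1 / 2 ^ n) * w₂ (1 / 2 ^ n)) atTop (𝓝 0) := by
  have hm : ∀ n : ℕ, (1 / 2 ^ n : ℝ) ∈ Icc (0 : ℝ) 1 := fun n =>
    ⟨by positivity, by rw [div_le_one (by positivity)]; exact one_le_pow₀ one_le_two⟩
  refine (tendsto_add_atTop_iff_nat 1).1 ?_
  refine squeeze_zero (fun n => W.mul_nonneg (hm _)) (fun n => ?_)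
    W.summable_dyadic.tendsto_atTop_zero
  exact (le_mul_of_one_le_left (W.mul_nonneg (hm _)) (one_le_pow₀ one_le_two)).trans
    (W.mul_dyadic_le n)

variable {B : V →L[𝕜] U →L[𝕜] E} (hB : ∀ v u, ‖B v u‖ ≤ ‖v‖ * ‖u‖)
  {γ₁ : ℝ → V} {γ₂ : ℝ → U} {w₁ w₂ Λ : ℝ → ℝ} (W : YoungControl w₁ w₂ Λ)
  (h₁ : HasModulus γ₁ w₁) (h₂ : HasModulus γ₂ w₂)

include hB W h₁ h₂

theorem norm_dyadicSum_succ_sub_le (n : ℕ) {t : ℝ} (ht : t ∈ Icc (0 : ℝ) 1) :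
    ‖dyadicSum B γ₁ γ₂ (n + 1) t - dyadicSum B γ₁ γ₂ n t‖ ≤
      Λ (1 / 2 ^ n) - Λ (1 / 2 ^ (n + 1)) := by
  refine le_trans ?_ (W.mul_dyadic_le n)
  have hc : ∀ k : ℕ, ((2 * k : ℕ) : ℝ) / 2 ^ (n + 1) = k / 2 ^ n := fun k => by
    push_cast; field_simp; ring
  have := leftSum_two_mul_sub B (fun k => γ₁ (k / 2 ^ (n + 1)))
    (fun k => γ₂ (min (k / 2 ^ (n + 1)) t)) (2 ^ n)
  simp only [hc, ← pow_succ'] at this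
  rw [dyadicSum, dyadicSum, this]
  refine (norm_sum_le _ _).trans ((Finset.sum_le_card_nsmul _ _
    (w₁ (1 / 2 ^ (n + 1)) * w₂ (1 / 2 ^ (n + 1))) fun k hk => ?_).trans_eq (by simp))
  have hk := Finset.mem_range.1 hk
  have hk1 : (k : ℝ) / 2 ^ n = 2 * k / 2 ^ (n + 1) := by rw [← hc]; push_cast; rfl
  have hk2 : (2 * k + 2 : ℝ) / 2 ^ (n + 1) ≤ 1 := by
    rw [div_le_one (by positivity), pow_succ]
    have : ((k + 1 : ℕ) : ℝ) ≤ 2 ^ n := by exact_mod_cast hk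
    push_cast at this
    linarith
  have e1 : (2 * k + 1 : ℝ) / 2 ^ (n + 1) = 2 * k / 2 ^ (n + 1) + 1 / 2 ^ (n + 1) := by ring
  have e2 : (2 * k + 2 : ℝ) / 2 ^ (n + 1) =
    2 * k / 2 ^ (n + 1) + 1 / 2 ^ (n + 1) + 1 / 2 ^ (n + 1) := by ring
  push_cast
  rw [hk1, e1, e2]
  rw [e2] at hk2
  have hx : (0 : ℝ) ≤ 2 * k / 2 ^ (n + 1) := by positivity
  have hd : (0 : ℝ) ≤ 1 / 2 ^ (n + 1) := by positivity
  generalize (2 * k / 2 ^ (n + 1) : ℝ) = x at *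
  generalize (1 / 2 ^ (n + 1) : ℝ) = d at *
  refine norm_bilin_increments_le hB W h₁ h₂ hx (by linarith) (by linarith)
    (le_min (by linarith) ht.1) (min_le_min_right _ (by linarith)) ((min_le_right _ _).trans ht.2)
    (by linarith) ?_ (by linarith)
  rcases min_cases (x + d + d) t with h | h <;> rcases min_cases (x + d) t with h' | h' <;>
    linarith

theorem cauchySeq_dyadicSum {t : ℝ} (ht : t ∈ Icc (0 : ℝ) 1) :
    CauchySeq fun n => dyadicSum B γ₁ γ₂ n t := by
  refine cauchySeq_of_dist_le_of_summable _ (fun n => ?_) W.summable_dyadic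
  rw [dist_comm, dist_eq_norm]
  exact norm_dyadicSum_succ_sub_le hB W h₁ h₂ n ht

/-- Clamping the dyadic points to `[s, t]` turns the increment of `dyadicSum` into a left sum over a
partition of `[s, t]`, up to the term of the dyadic interval which contains `s` in its interior. -/
theorem norm_dyadicSum_sub_sub_le (n : ℕ) {s t : ℝ} (hs : 0 ≤ s) (hst : s ≤ t) (ht : t ≤ 1) :
    ‖dyadicSum B γ₁ γ₂ n t - dyadicSum B γ₁ γ₂ n s - B (γ₁ s) (γ₂ t - γ₂ s)‖ ≤
      2 * (w₁ (t - s) * w₂ (t - s)) + 2 * (t - s) * Λ (t - s) +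
        w₁ (1 / 2 ^ n) * w₂ (1 / 2 ^ n) := by
  set x : ℕ → ℝ := fun k => k / 2 ^ n with hx
  set y : ℕ → ℝ := fun k => max s (min (x k) t) with hy
  have hxm : Monotone x := fun a b hab => by simp only [hx]; gcongr
  have hym : Monotone y := fun a b hab => max_le_max_left _ (min_le_min_right _ (hxm hab))
  have hyI : ∀ k, y k ∈ Icc (0 : ℝ) 1 := fun k =>
    ⟨hs.trans (le_max_left _ _), max_le (hst.trans ht) ((min_le_right _ _).trans ht)⟩
  have hx0 : x 0 = 0 := by simp [hx]
  have hx1 : x (2 ^ n) = 1 := by simp [hx]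
  have hxs : ∀ k, x (k + 1) = x k + 1 / 2 ^ n := fun k => by simp only [hx]; push_cast; ring
  have hxn : ∀ k, 0 ≤ x k := fun k => by simp only [hx]; positivity
  have hy0 : y 0 = s := by simp [hy, hx0, hs.trans hst, hs]
  have hy1 : y (2 ^ n) = t := by simp [hy, hx1, ht, hst]
  have hd1 : (1 / 2 ^ n : ℝ) ∈ Icc (0 : ℝ) 1 :=
    ⟨by positivity, by rw [div_le_one (by positivity)]; exact one_le_pow₀ one_le_two⟩
  have hg : ∀ k, γ₂ (min (x k) t) - γ₂ (min (x k) s) = γ₂ (y k) - γ₂ s := by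
    intro k
    rcases le_total (x k) s with h | h
    · simp [hy, min_eq_left h, min_eq_left (h.trans hst), max_eq_left h]
    · simp [hy, min_eq_right h, max_eq_right (le_min h hst)]
  have hsum : dyadicSum B γ₁ γ₂ n t - dyadicSum B γ₁ γ₂ n s =
      leftSum B (fun k => γ₁ (x k)) (fun k => γ₂ (y k)) (2 ^ n) := by
    simp only [dyadicSum, leftSum, ← Finset.sum_sub_distrib, ← map_sub]
    refine Finset.sum_congr rfl fun k _ => ?_
    congr 1
    have a := hg k
    have b := hg (k + 1)
    simp only [hx] at a b
    rw [sub_sub_sub_comm, b, a, sub_sub_sub_cancel_right]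
  have hdec : dyadicSum B γ₁ γ₂ n t - dyadicSum B γ₁ γ₂ n s - B (γ₁ s) (γ₂ t - γ₂ s) =
      leftSum B (fun k => γ₁ (y k) - γ₁ (y 0)) (fun k => γ₂ (y k)) (2 ^ n) +
      leftSum B (fun k => γ₁ (x k) - γ₁ (y k)) (fun k => γ₂ (y k)) (2 ^ n) := by
    rw [hsum, leftSum_sub, leftSum_sub, leftSum_const, hy0, hy1]
    abel
  rw [hdec]
  refine (norm_add_le _ _).trans (add_le_add ?_ ?_)
  · have := norm_leftSum_le hB W h₁ h₂ (2 ^ n) y hym hyI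
    simpa only [hy0, hy1] using this
  · -- `φ` jumps once, between the two dyadic points that surround `s`.
    let φ : ℕ → ℝ := fun k => if s < x k then 1 else 0
    have hE := W.mul_nonneg hd1
    refine (norm_sum_le _ _).trans ((Finset.sum_le_sum (g := fun k =>
      w₁ (1 / 2 ^ n) * w₂ (1 / 2 ^ n) * (φ (k + 1) - φ k)) fun k hk => ?_).trans ?_)
    · have hk := Finset.mem_range.1 hk
      have hk1 : x (k + 1) ≤ 1 := hx1 ▸ hxm (Nat.succ_le_of_lt hk)
      have hkk := hxm (Nat.le_succ k)
      rcases lt_or_ge s (x k) with h | h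
      · have h' : s < x (k + 1) := h.trans_le hkk
        have : B (γ₁ (x k) - γ₁ (y k)) (γ₂ (y (k + 1)) - γ₂ (y k)) = 0 := by
          rcases le_total (x k) t with h2 | h2
          · have : y k = x k := by simp [hy, min_eq_left h2, h.le]
            simp [this]
          · have : y (k + 1) = y k := by simp [hy, min_eq_right h2, min_eq_right (h2.trans hkk)]
            simp [this]
        simp only [φ, h, h', this, if_true, sub_self, mul_zero, norm_zero, le_refl]
      · have hyk : y k = s := by simp [hy, min_eq_left (h.trans hst), h]
        rcases lt_or_ge s (x (k + 1)) with h' | h'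
        · simp only [φ, h', h.not_gt, if_true, if_false, sub_zero, mul_one, hyk]
          rw [← norm_neg, ← neg_apply, ← map_neg, neg_sub]
          refine norm_bilin_increments_le hB W h₁ h₂ (hxn k) h (hst.trans ht) hs
            (le_max_left _ _) (hyI _).2 ?_ ?_ hd1.2
          · linarith [hxs k]
          · have : y (k + 1) ≤ x (k + 1) := max_le h'.le (min_le_left _ _)
            linarith [hxs k]
        · have : y (k + 1) = s := by simp [hy, min_eq_left (h'.trans hst), h']
          simp [φ, h.not_gt, h'.not_gt, this, hyk]
    · rw [← Finset.mul_sum, Finset.sum_range_sub]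
      refine mul_le_of_le_one_right hE ?_
      simp only [φ]
      split_ifs <;> norm_num

/-- The indefinite integral of `γ₁` against `γ₂`. The bound on its increments determines it up to a
constant, because the right-hand side is `o(t - s)`. -/
theorem exists_indefinite_integral [CompleteSpace E] :
    ∃ J : ℝ → E, ∀ s t, 0 ≤ s → s ≤ t → t ≤ 1 →
      ‖J t - J s - B (γ₁ s) (γ₂ t - γ₂ s)‖ ≤
        2 * (w₁ (t - s) * w₂ (t - s)) + 2 * (t - s) * Λ (t - s) := by
  have hex : ∀ t : ℝ, ∃ z : E, t ∈ Icc (0 : ℝ) 1 →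
      Tendsto (fun n => dyadicSum B γ₁ γ₂ n t) atTop (𝓝 z) := by
    intro t
    by_cases ht : t ∈ Icc (0 : ℝ) 1
    · obtain ⟨z, hz⟩ := cauchySeq_tendsto_of_complete (cauchySeq_dyadicSum hB W h₁ h₂ ht)
      exact ⟨z, fun _ => hz⟩
    · exact ⟨0, fun h => absurd h ht⟩
  choose J hJ using hex
  refine ⟨J, fun s t hs hst ht => ?_⟩
  have hlim := (((hJ t ⟨hs.trans hst, ht⟩).sub (hJ s ⟨hs, hst.trans ht⟩)).sub
    (tendsto_const_nhds (x := B (γ₁ s) (γ₂ t - γ₂ s)))).norm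
  have hr := (tendsto_const_nhds (x := 2 * (w₁ (t - s) * w₂ (t - s)) +
    2 * (t - s) * Λ (t - s))).add W.tendsto_mul_dyadic
  rw [add_zero] at hr
  exact le_of_tendsto_of_tendsto' hlim hr fun n =>
    norm_dyadicSum_sub_sub_le hB W h₁ h₂ n hs hst ht

end Dyadic

/-! ### Partitions and Riemann–Stieltjes integrals -/

namespace FinitePartition

variable {a b : ℝ} (D : FinitePartition a b)

theorem pts_le {i j : ℕ} (hij : i ≤ j) (hj : j ≤ D.n) : D.pts i ≤ D.pts j := by
  induction j, hij using Nat.le_induction with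
  | base => exact le_rfl
  | succ j _ ih => exact (ih (by omega)).trans (D.pts_lt j (by omega)).le

theorem le_pts {i : ℕ} (hi : i ≤ D.n) : a ≤ D.pts i :=
  D.pts_zero.symm.trans_le (D.pts_le (Nat.zero_le i) hi)

theorem pts_le_right {i : ℕ} (hi : i ≤ D.n) : D.pts i ≤ b :=
  (D.pts_le hi le_rfl).trans_eq D.pts_last

theorem sum_sub {E : Type*} [AddCommGroup E] (g : ℝ → E) :
    ∑ i ∈ Finset.range D.n, (g (D.pts (i + 1)) - g (D.pts i)) = g b - g a := by
  rw [Finset.sum_range_sub (fun i => g (D.pts i)), D.pts_last, D.pts_zero]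

theorem exists_meshLE (hab : a ≤ b) {δ : ℝ} (hδ : 0 < δ) :
    ∃ D : FinitePartition a b, D.MeshLE δ := by
  rcases hab.eq_or_lt with rfl | hab
  · exact ⟨⟨0, fun _ => a, fun i hi => absurd hi (Nat.not_lt_zero i), rfl, rfl⟩,
      fun i hi => absurd hi (Nat.not_lt_zero i)⟩
  · obtain ⟨n, hn⟩ := exists_nat_gt ((b - a) / δ)
    have hn0 : (0 : ℝ) < n := (div_pos (sub_pos.2 hab) hδ).trans hn
    have hpos : 0 < (b - a) / n := div_pos (sub_pos.2 hab) hn0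
    refine ⟨⟨n, fun i => a + i * ((b - a) / n), fun i _ => ?_, by simp, ?_⟩, fun i _ => ?_⟩
    · push_cast; linarith
    · field_simp; ring
    · have : (b - a) / n ≤ δ := (div_le_comm₀ hδ hn0).1 hn.le
      push_cast; linarith

end FinitePartition

/-- A two-parameter function with Hölder exponent `1 / r` has finite `r`-variation: the powers of
its increments are bounded by the lengths of the intervals, which add up to `1`. -/
theorem pVariation_le_of_le {E : Type*} [NormedAddCommGroup E] {r : ℝ} (hr : 0 < r)
    {α : ℝ → ℝ → E} {K : ℝ≥0∞}
    (h : ∀ s t, 0 ≤ s → s ≤ t → t ≤ 1 → ‖α s t‖ₑ ≤ K * ENNReal.ofReal (t - s) ^ (1 / r)) :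
    pVariation r α 0 1 ≤ K := by
  have key : ∀ D : FinitePartition 0 1,
      ∑ i ∈ Finset.range D.n, ‖α (D.pts i) (D.pts (i + 1))‖ₑ ^ r ≤ K ^ r := by
    intro D
    calc ∑ i ∈ Finset.range D.n, ‖α (D.pts i) (D.pts (i + 1))‖ₑ ^ r
        ≤ ∑ i ∈ Finset.range D.n, K ^ r * ENNReal.ofReal (D.pts (i + 1) - D.pts i) := by
          refine Finset.sum_le_sum fun i hi => ?_
          have hi := Finset.mem_range.1 hi
          refine (ENNReal.rpow_le_rpow (h _ _ (D.le_pts hi.le) (D.pts_lt i hi).le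
            (D.pts_le_right hi)) hr.le).trans_eq ?_
          rw [ENNReal.mul_rpow_of_nonneg _ _ hr.le, ← ENNReal.rpow_mul,
            one_div_mul_cancel hr.ne', ENNReal.rpow_one]
      _ = K ^ r := by
          rw [← Finset.mul_sum, ← ENNReal.ofReal_sum_of_nonneg, D.sum_sub fun x => x]
          · simp
          · exact fun i hi => sub_nonneg.2 (D.pts_lt i (Finset.mem_range.1 hi)).le
  calc pVariation r α 0 1 ≤ (K ^ r) ^ (1 / r) :=
        ENNReal.rpow_le_rpow (iSup_le key) (by positivity)
    _ = K := by rw [← ENNReal.rpow_mul, mul_one_div_cancel hr.ne', ENNReal.rpow_one]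

theorem hasModulus_of_modulusConst {E : Type*} [NormedAddCommGroup E] {γ : ℝ → E} {r : ℝ}
    {m : ℝ → ℝ} (hr : 0 < r) (hm : ∀ t ∈ Icc (0 : ℝ) 1, 0 ≤ m t) {C : ℝ≥0∞}
    (hC : C = modulusConst γ r m) (hfin : C < ∞) :
    HasModulus γ fun h => C.toReal * (h ^ r * m h) := by
  intro s t hs hst ht
  rcases hst.eq_or_lt with rfl | hlt
  · simp [Real.zero_rpow hr.ne']
  have h0 : 0 ≤ (t - s) ^ r * m (t - s) := mul_nonneg (Real.rpow_nonneg (by linarith) _)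
    (hm _ ⟨by linarith, by linarith⟩)
  have h1 : ‖γ t - γ s‖ₑ / ENNReal.ofReal ((t - s) ^ r * m (t - s)) ≤ C := by
    rw [hC]
    exact le_iSup_of_le s (le_iSup_of_le t (le_iSup_of_le ⟨hs, hlt, ht⟩ le_rfl))
  rw [ENNReal.div_le_iff_le_mul (Or.inr hfin.ne) (Or.inl ENNReal.ofReal_ne_top)] at h1
  have := ENNReal.toReal_mono (ENNReal.mul_ne_top hfin.ne ENNReal.ofReal_ne_top) h1
  rwa [toReal_enorm, ENNReal.toReal_mul, ENNReal.toReal_ofReal h0] at this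

section RiemannStieltjes

variable {𝕜 V U : Type*} [RCLike 𝕜] [NormedAddCommGroup V] [NormedSpace 𝕜 V]
  [NormedAddCommGroup U] [NormedSpace 𝕜 U] (N : TensorNorm 𝕜 V U)

theorem TensorNorm.norm_tmul_le (v : V) (u : U) : ‖N.tmul v u‖ ≤ ‖v‖ * ‖u‖ :=
  (UniformSpace.Completion.norm_coe _).trans_le (N.tmul_le' v u)

/-- The elementary tensor map as a continuous bilinear map. -/
noncomputable def TensorNorm.tmulL : V →L[𝕜] U →L[𝕜] CompletedTensor N :=
  let ι := UniformSpace.Completion.toComplₗᵢ (𝕜 := 𝕜) (E := NormedTensor N)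
  LinearMap.mkContinuous₂
    (LinearMap.mk₂ 𝕜 N.tmul
      (fun v v' u => (congrArg ι (TensorProduct.add_tmul v v' u)).trans (map_add ι _ _))
      (fun c v u => (congrArg ι (TensorProduct.smul_tmul' c v u).symm).trans (map_smul ι c _))
      (fun v u u' => (congrArg ι (TensorProduct.tmul_add v u u')).trans (map_add ι _ _))
      (fun c v u => (congrArg ι (TensorProduct.tmul_smul c v u)).trans (map_smul ι c _)))
    1 (fun v u => by rw [one_mul]; exact N.norm_tmul_le v u)

theorem TensorNorm.tmulL_apply (v : V) (u : U) : N.tmulL v u = N.tmul v u := rfl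

theorem TensorNorm.norm_tmulL_le (v : V) (u : U) : ‖N.tmulL v u‖ ≤ ‖v‖ * ‖u‖ :=
  N.norm_tmul_le v u

variable {N}

theorem HasRSIntegral.unique {f : ℝ → V} {g : ℝ → U} {a b : ℝ} (hab : a ≤ b)
    {J J' : CompletedTensor N} (h : HasRSIntegral N f g a b J)
    (h' : HasRSIntegral N f g a b J') : J = J' := by
  refine eq_of_forall_dist_le fun ε hε => ?_
  obtain ⟨δ, hδ, H⟩ := h (ε / 2) (half_pos hε)
  obtain ⟨δ', hδ', H'⟩ := h' (ε / 2) (half_pos hε)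
  obtain ⟨D, hD⟩ := FinitePartition.exists_meshLE hab (lt_min hδ hδ')
  have hξ : ∀ i < D.n, D.pts i ∈ Icc (D.pts i) (D.pts (i + 1)) :=
    fun i hi => ⟨le_rfl, (D.pts_lt i hi).le⟩
  have a1 := H D (fun i hi => (hD i hi).trans (min_le_left _ _)) D.pts hξ
  have a2 := H' D (fun i hi => (hD i hi).trans (min_le_right _ _)) D.pts hξ
  rw [← dist_eq_norm] at a1 a2
  have := dist_triangle_left J J' (riemannSum N f g D D.pts)
  linarith

theorem HasRSIntegral.rsIntegral_eq {f : ℝ → V} {g : ℝ → U} {a b : ℝ} (hab : a ≤ b)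
    {J : CompletedTensor N} (h : HasRSIntegral N f g a b J) : rsIntegral N f g a b = J := by
  have hi : RSIntegrable N f g a b := ⟨J, h⟩
  rw [rsIntegral, dif_pos hi]
  exact hi.choose_spec.unique hab h

theorem HasRSIntegral.sub_const {f : ℝ → V} {g : ℝ → U} {a b : ℝ} {J : CompletedTensor N}
    (h : HasRSIntegral N f g a b J) (v : V) :
    HasRSIntegral N (fun u => f u - v) g a b (J - N.tmulL v (g b - g a)) := by
  intro ε hε
  obtain ⟨δ, hδ, H⟩ := h ε hε
  refine ⟨δ, hδ, fun D hD ξ hξ => ?_⟩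
  have e : riemannSum N (fun u => f u - v) g D ξ =
      riemannSum N f g D ξ - N.tmulL v (g b - g a) := by
    simp only [riemannSum, ← TensorNorm.tmulL_apply, map_sub N.tmulL, sub_apply,
      Finset.sum_sub_distrib]
    rw [← map_sum, D.sum_sub]
  rw [e, sub_sub_sub_cancel_right]
  exact H D hD ξ hξ

/-- Riemann sums with arbitrary representative points converge to the increment of the indefinite
integral: the error on an interval of length `d` is at most `8 d Λ(2 d)`. -/
theorem hasRSIntegral_of_increments {γ₁ : ℝ → V} {γ₂ : ℝ → U} {w₁ w₂ Λ : ℝ → ℝ}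
    (W : YoungControl w₁ w₂ Λ) (h₁ : HasModulus γ₁ w₁) (h₂ : HasModulus γ₂ w₂)
    {J : ℝ → CompletedTensor N}
    (hJ : ∀ s t, 0 ≤ s → s ≤ t → t ≤ 1 → ‖J t - J s - N.tmulL (γ₁ s) (γ₂ t - γ₂ s)‖ ≤
      2 * (w₁ (t - s) * w₂ (t - s)) + 2 * (t - s) * Λ (t - s))
    {a b : ℝ} (ha : 0 ≤ a) (hb : b ≤ 1) : HasRSIntegral N γ₁ γ₂ a b (J b - J a) := by
  intro ε hε
  obtain ⟨h, hΛ, hh0, hh1⟩ : ∃ h, Λ h < ε / 8 ∧ 0 < h ∧ h ≤ 1 :=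
    ((W.tendsto_zero.eventually_lt_const (by positivity : (0 : ℝ) < ε / 8)).and
      (Ioc_mem_nhdsGT one_pos)).exists
  refine ⟨h / 2, half_pos hh0, fun D hD ξ hξ => ?_⟩
  have hab : b - a ≤ 1 := by linarith
  rw [riemannSum, ← D.sum_sub J, ← Finset.sum_sub_distrib]
  refine (norm_sum_le _ _).trans_lt ((Finset.sum_le_sum (g := fun i =>
    8 * Λ h * (D.pts (i + 1) - D.pts i)) fun i hi => ?_).trans_lt ?_)
  · have hi := Finset.mem_range.1 hi
    have hs := ha.trans (D.le_pts hi.le)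
    have ht := (D.pts_le_right hi).trans hb
    have hst := D.pts_lt i hi
    have hd := hD i hi
    obtain ⟨hξ1, hξ2⟩ := hξ i hi
    rw [← TensorNorm.tmulL_apply]
    generalize ξ i = x at *
    generalize D.pts i = s at *
    generalize D.pts (i + 1) = t at *
    have b1 := norm_bilin_increments_le N.norm_tmulL_le W h₁ h₂ hs hξ1 (hξ2.trans ht) hs hst.le ht
      (h := t - s) (by linarith) le_rfl (by linarith)
    have b2 := hJ s t hs hst.le ht
    have hd0 : 0 < t - s := by linarith
    have b3 : Λ (t - s) ≤ Λ h := W.mono hd0 (by linarith) hh1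
    have b4 : w₁ (t - s) * w₂ (t - s) ≤ 2 * (t - s) * Λ h := by
      refine (W.mul_le_of_two_mul_le hd0 (by linarith)).trans ?_
      have : Λ (2 * (t - s)) ≤ Λ h := W.mono (by linarith) (by linarith) hh1
      have := W.nonneg (t - s)
      gcongr
      linarith
    have b5 : 2 * (t - s) * Λ (t - s) ≤ 2 * (t - s) * Λ h := by gcongr
    have e : N.tmulL (γ₁ x) (γ₂ t - γ₂ s) - (J t - J s) =
        N.tmulL (γ₁ x - γ₁ s) (γ₂ t - γ₂ s) -
          (J t - J s - N.tmulL (γ₁ s) (γ₂ t - γ₂ s)) := by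
      rw [map_sub N.tmulL, sub_apply]; abel
    rw [e]
    refine (norm_sub_le _ _).trans ?_
    linarith
  · rw [← Finset.mul_sum, D.sum_sub fun x => x]
    have := W.nonneg h
    calc 8 * Λ h * (b - a) ≤ 8 * Λ h * 1 := by gcongr
      _ < ε := by linarith

end RiemannStieltjes

/-! ### The generalized Young integral -/

/-- The moduli `c₁ h^(1/p) m₁(h)` and `c₂ h^(1/q) m₂(h)` are controlled by
`Λ(T) = c₁ c₂ ∫₀ᵀ m₁(t) m₂(t) / t dt`, since `m₁ m₂` is non-decreasing. -/
theorem youngControl_of_integral {p q : ℝ} (hp : 0 < p) (hq : 0 < q) (hpq : p⁻¹ + q⁻¹ = 1)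
    {m₁ m₂ : ℝ → ℝ} (hm₁ : ∀ t ∈ Icc (0 : ℝ) 1, 0 ≤ m₁ t) (hm₂ : ∀ t ∈ Icc (0 : ℝ) 1, 0 ≤ m₂ t)
    (hm₁' : MonotoneOn m₁ (Icc 0 1)) (hm₂' : MonotoneOn m₂ (Icc 0 1))
    (hfin : ∫⁻ t in Ioc (0 : ℝ) 1, ENNReal.ofReal (m₁ t * m₂ t / t) ≠ ∞)
    {c₁ c₂ : ℝ} (hc₁ : 0 ≤ c₁) (hc₂ : 0 ≤ c₂) :
    YoungControl (fun h => c₁ * (h ^ (1 / p) * m₁ h)) (fun h => c₂ * (h ^ (1 / q) * m₂ h))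
      (fun T => c₁ * c₂ * (∫⁻ t in Ioc (0 : ℝ) T, ENNReal.ofReal (m₁ t * m₂ t / t)).toReal) where
  nonneg₁ h hh := mul_nonneg hc₁ (mul_nonneg (Real.rpow_nonneg hh.1 _) (hm₁ h hh))
  nonneg₂ h hh := mul_nonneg hc₂ (mul_nonneg (Real.rpow_nonneg hh.1 _) (hm₂ h hh))
  mono₁ a ha b hb hab := mul_le_mul_of_nonneg_left (mul_le_mul
    (Real.rpow_le_rpow ha.1 hab (by positivity)) (hm₁' ha hb hab) (hm₁ a ha)
    (Real.rpow_nonneg hb.1 _)) hc₁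
  mono₂ a ha b hb hab := mul_le_mul_of_nonneg_left (mul_le_mul
    (Real.rpow_le_rpow ha.1 hab (by positivity)) (hm₂' ha hb hab) (hm₂ a ha)
    (Real.rpow_nonneg hb.1 _)) hc₂
  nonneg T := mul_nonneg (mul_nonneg hc₁ hc₂) ENNReal.toReal_nonneg
  tendsto_zero := by
    have hvol : Tendsto ((volume.restrict (Ioc (0 : ℝ) 1)) ∘ fun T => Ioc (0 : ℝ) T) (𝓝[>] 0)
        (𝓝 0) := by
      have h : Tendsto (fun T : ℝ => ENNReal.ofReal (T - 0)) (𝓝[>] 0) (𝓝 0) := by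
        have : Continuous fun T : ℝ => ENNReal.ofReal (T - 0) :=
          ENNReal.continuous_ofReal.comp (continuous_id.sub continuous_const)
        simpa using (this.tendsto 0).mono_left nhdsWithin_le_nhds
      refine tendsto_of_tendsto_of_tendsto_of_le_of_le tendsto_const_nhds h
        (fun _ => zero_le) (fun T => ?_)
      exact (Measure.restrict_apply_le _ _).trans_eq Real.volume_Ioc
    have h := (ENNReal.tendsto_toReal ENNReal.zero_ne_top).comp
      (tendsto_setLIntegral_zero hfin hvol)
    have h' := h.const_mul (c₁ * c₂)
    rw [ENNReal.toReal_zero, mul_zero] at h'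
    refine h'.congr' ?_
    filter_upwards [Ioc_mem_nhdsGT one_pos] with T hT
    simp only [Function.comp_apply]
    rw [Measure.restrict_restrict measurableSet_Ioc,
      inter_eq_left.2 (Ioc_subset_Ioc_right hT.2)]
  step a b ha hab hb := by
    set f : ℝ → ℝ≥0∞ := fun t => ENNReal.ofReal (m₁ t * m₂ t / t)
    have hb0 := ha.trans_le hab
    have haI : a ∈ Icc (0 : ℝ) 1 := ⟨ha.le, hab.trans hb⟩
    have hμ : 0 ≤ m₁ a * m₂ a := mul_nonneg (hm₁ a haI) (hm₂ a haI)
    have hle : ∀ T ≤ 1, ∫⁻ t in Ioc (0 : ℝ) T, f t ≠ ∞ := fun T hT =>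
      ((lintegral_mono_set (Ioc_subset_Ioc_right hT)).trans_lt (lt_top_iff_ne_top.2 hfin)).ne
    have hsplit : ∫⁻ t in Ioc (0 : ℝ) b, f t =
        (∫⁻ t in Ioc (0 : ℝ) a, f t) + ∫⁻ t in Ioc a b, f t := by
      rw [← Ioc_union_Ioc_eq_Ioc ha.le hab, lintegral_union measurableSet_Ioc]
      exact Ioc_disjoint_Ioc_of_le le_rfl
    have hlow : ENNReal.ofReal (m₁ a * m₂ a / b * (b - a)) ≤ ∫⁻ t in Ioc a b, f t := by
      rw [ENNReal.ofReal_mul (by positivity), ← Real.volume_Ioc, ← setLIntegral_const]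
      refine setLIntegral_mono' measurableSet_Ioc fun t ht => ENNReal.ofReal_le_ofReal ?_
      have htI : t ∈ Icc (0 : ℝ) 1 := ⟨(ha.trans ht.1).le, ht.2.trans hb⟩
      exact div_le_div₀ (mul_nonneg (hm₁ t htI) (hm₂ t htI))
        (mul_le_mul (hm₁' haI htI ht.1.le) (hm₂' haI htI ht.1.le) (hm₂ a haI) (hm₁ t htI))
        (ha.trans ht.1) ht.2
    have hne : ∫⁻ t in Ioc a b, f t ≠ ∞ := fun h => hle b hb (by rw [hsplit, h, add_top])
    have hreal := (ENNReal.ofReal_le_iff_le_toReal hne).1 hlow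
    rw [hsplit, ENNReal.toReal_add (hle a haI.2) hne, mul_add, add_sub_cancel_left]
    have hpow : a ^ (1 / p) * a ^ (1 / q) = a := by
      rw [← Real.rpow_add ha, one_div, one_div, hpq, Real.rpow_one]
    calc c₁ * (a ^ (1 / p) * m₁ a) * (c₂ * (a ^ (1 / q) * m₂ a)) * (b - a)
        = c₁ * c₂ * (a ^ (1 / p) * a ^ (1 / q)) * (m₁ a * m₂ a) * (b - a) := by ring
      _ = c₁ * c₂ * (a * b) * (m₁ a * m₂ a / b * (b - a)) := by rw [hpow]; field_simp
      _ ≤ c₁ * c₂ * (a * b) * (∫⁻ t in Ioc a b, f t).toReal := by gcongr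
      _ = _ := by ring

theorem continuousOn_of_norm_sub_le_rpow {E : Type*} [NormedAddCommGroup E] {J : ℝ → E}
    {k r : ℝ} {S : Set ℝ} (hr : 0 < r)
    (h : ∀ s ∈ S, ∀ t ∈ S, s ≤ t → ‖J t - J s‖ ≤ k * (t - s) ^ r) : ContinuousOn J S := by
  intro s hs
  refine tendsto_iff_norm_sub_tendsto_zero.2 ?_
  have hlim : Tendsto (fun t => k * |t - s| ^ r) (𝓝[S] s) (𝓝 0) := by
    have : Continuous fun t : ℝ => k * |t - s| ^ r :=
      continuous_const.mul ((continuous_id.sub continuous_const).abs.rpow_const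
        fun _ => Or.inr hr.le)
    have h0 := this.tendsto s
    simp only [sub_self, abs_zero, Real.zero_rpow hr.ne', mul_zero] at h0
    exact h0.mono_left nhdsWithin_le_nhds
  refine squeeze_zero' (Eventually.of_forall fun _ => norm_nonneg _) ?_ hlim
  filter_upwards [self_mem_nhdsWithin] with t ht
  rcases le_total s t with hst | hst
  · rw [abs_of_nonneg (sub_nonneg.2 hst)]
    exact h s hs t ht hst
  · rw [abs_sub_comm, abs_of_nonneg (sub_nonneg.2 hst), norm_sub_rev]
    exact h t ht s hs hst

theorem enorm_le_of_norm_le_rpow {E : Type*} [NormedAddCommGroup E] {x : E} {k d r : ℝ}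
    {K : ℝ≥0∞} (hd : 0 ≤ d) (hr : 0 ≤ r) (h : ‖x‖ ≤ k * d ^ r) (hK : ENNReal.ofReal k ≤ K) :
    ‖x‖ₑ ≤ K * ENNReal.ofReal d ^ r := by
  rw [ENNReal.ofReal_rpow_of_nonneg hd hr, ← ofReal_norm]
  refine (ENNReal.ofReal_le_ofReal h).trans ?_
  rw [ENNReal.ofReal_mul' (Real.rpow_nonneg hd r)]
  gcongr

theorem mainTheorem1 {𝕜 V₁ V₂ : Type*} [RCLike 𝕜]
    [NormedAddCommGroup V₁] [NormedSpace 𝕜 V₁] [CompleteSpace V₁]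
    [NormedAddCommGroup V₂] [NormedSpace 𝕜 V₂] [CompleteSpace V₂]
    (N : TensorNorm 𝕜 V₁ V₂)
    (γ₁ : ℝ → V₁) (γ₂ : ℝ → V₂)
    (hγ₁ : ContinuousOn γ₁ (Icc 0 1)) (hγ₂ : ContinuousOn γ₂ (Icc 0 1))
    (p q : ℝ) (hp : 1 < p) (hq : 1 < q) (hpq : p⁻¹ + q⁻¹ = 1)
    (m₁ m₂ : ℝ → ℝ)
    (hm₁_nonneg : ∀ t ∈ Icc (0 : ℝ) 1, 0 ≤ m₁ t) (hm₂_nonneg : ∀ t ∈ Icc (0 : ℝ) 1, 0 ≤ m₂ t)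
    (hm₁_mono : MonotoneOn m₁ (Icc 0 1)) (hm₂_mono : MonotoneOn m₂ (Icc 0 1))
    (hm₁_lim : Tendsto m₁ (𝓝[>] 0) (𝓝 0)) (hm₂_lim : Tendsto m₂ (𝓝[>] 0) (𝓝 0))
    (hm₁_one : m₁ 1 ≤ 1) (hm₂_one : m₂ 1 ≤ 1)
    (L : ℝ≥0∞) (hL : L = ∫⁻ t in Ioc (0 : ℝ) 1, ENNReal.ofReal (m₁ t * m₂ t / t))
    (hL_fin : L < ∞)
    (C₁ C₂ : ℝ≥0∞)
    (hC₁ : C₁ = modulusConst γ₁ (1 / p) m₁) (hC₂ : C₂ = modulusConst γ₂ (1 / q) m₂)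
    (hC₁_fin : C₁ < ∞) (hC₂_fin : C₂ < ∞) :
    -- the integrals `∫₀ᵗ γ₁ ⊗ dγ₂` exist, and form a continuous path of finite `q`-variation
    (∀ t ∈ Icc (0 : ℝ) 1, RSIntegrable N γ₁ γ₂ 0 t) ∧
    ContinuousOn (fun t => rsIntegral N γ₁ γ₂ 0 t) (Icc 0 1) ∧
    (γ₁ 0 = 0 →
      pathPVariation q (fun t => rsIntegral N γ₁ γ₂ 0 t) 0 1 ≤ 8 * C₁ * C₂ * (2 + L)) ∧
    pathPVariation q (fun t => rsIntegral N γ₁ γ₂ 0 t) 0 1 ≤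
      8 * C₁ * C₂ * (2 + L) + ‖γ₁ 0‖ₑ * C₂ ∧
    -- the iterated integrals exist, are continuous and of finite `1`-variation
    (∀ s t : ℝ, 0 ≤ s → s ≤ t → t ≤ 1 → RSIntegrable N (fun u => γ₁ u - γ₁ s) γ₂ s t) ∧
    ContinuousOn (fun x : ℝ × ℝ => iteratedRSIntegral N γ₁ γ₂ x.1 x.2)
      {x | 0 ≤ x.1 ∧ x.1 ≤ x.2 ∧ x.2 ≤ 1} ∧
    pVariation 1 (iteratedRSIntegral N γ₁ γ₂) 0 1 ≤ C₁ * C₂ * (15 + 8 * L) := by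
  have hp0 : 0 < p := one_pos.trans hp
  have hq0 : 0 < q := one_pos.trans hq
  set c₁ := C₁.toReal with hc₁
  set c₂ := C₂.toReal with hc₂
  set l := L.toReal with hl
  have hc₁0 : 0 ≤ c₁ := ENNReal.toReal_nonneg
  have hc₂0 : 0 ≤ c₂ := ENNReal.toReal_nonneg
  have hl0 : 0 ≤ l := ENNReal.toReal_nonneg
  have eC₁ : ENNReal.ofReal c₁ = C₁ := ENNReal.ofReal_toReal hC₁_fin.ne
  have eC₂ : ENNReal.ofReal c₂ = C₂ := ENNReal.ofReal_toReal hC₂_fin.ne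
  have eL : ENNReal.ofReal l = L := ENNReal.ofReal_toReal hL_fin.ne
  have W := youngControl_of_integral hp0 hq0 hpq hm₁_nonneg hm₂_nonneg hm₁_mono hm₂_mono
    (hL ▸ hL_fin.ne) hc₁0 hc₂0
  have H₁ := hasModulus_of_modulusConst (one_div_pos.2 hp0) hm₁_nonneg hC₁ hC₁_fin
  have H₂ := hasModulus_of_modulusConst (one_div_pos.2 hq0) hm₂_nonneg hC₂ hC₂_fin
  have hm₁_le : ∀ h ∈ Icc (0 : ℝ) 1, m₁ h ≤ 1 := fun h hh =>
    (hm₁_mono hh (right_mem_Icc.2 zero_le_one) hh.2).trans hm₁_one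
  have hm₂_le : ∀ h ∈ Icc (0 : ℝ) 1, m₂ h ≤ 1 := fun h hh =>
    (hm₂_mono hh (right_mem_Icc.2 zero_le_one) hh.2).trans hm₂_one
  obtain ⟨J, hJ⟩ := exists_indefinite_integral N.norm_tmulL_le W H₁ H₂
  have hint : ∀ s t, 0 ≤ s → t ≤ 1 → HasRSIntegral N γ₁ γ₂ s t (J t - J s) :=
    fun s t hs ht => hasRSIntegral_of_increments W H₁ H₂ hJ hs ht
  -- The iterated integral over `[s, t]` is of order `t - s`.
  have hinc : ∀ s t, 0 ≤ s → s ≤ t → t ≤ 1 →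
      ‖J t - J s - N.tmulL (γ₁ s) (γ₂ t - γ₂ s)‖ ≤ c₁ * c₂ * (2 + 2 * l) * (t - s) := by
    intro s t hs hst ht
    refine (hJ s t hs hst ht).trans ?_
    rcases hst.eq_or_lt with rfl | hlt
    · simp [Real.zero_rpow, hp0.ne', hq0.ne']
    have hd0 : 0 < t - s := sub_pos.2 hlt
    have hdI : t - s ∈ Icc (0 : ℝ) 1 := ⟨hd0.le, by linarith⟩
    have hΛ := W.mono hd0 hdI.2 le_rfl
    simp only [← hL, ← hl] at hΛ
    generalize t - s = d at *
    have hpow : d ^ (1 / p) * d ^ (1 / q) = d := by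
      rw [← Real.rpow_add hd0, one_div, one_div, hpq, Real.rpow_one]
    have hw : c₁ * (d ^ (1 / p) * m₁ d) * (c₂ * (d ^ (1 / q) * m₂ d)) ≤ c₁ * c₂ * d := by
      calc c₁ * (d ^ (1 / p) * m₁ d) * (c₂ * (d ^ (1 / q) * m₂ d))
          = c₁ * c₂ * (d ^ (1 / p) * d ^ (1 / q)) * (m₁ d * m₂ d) := by ring
        _ ≤ c₁ * c₂ * d * 1 := by
          rw [hpow]
          gcongr
          exact mul_le_one₀ (hm₁_le d hdI) (hm₂_nonneg d hdI) (hm₂_le d hdI)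
        _ = c₁ * c₂ * d := mul_one _
    have := mul_le_mul_of_nonneg_left hΛ (mul_nonneg zero_le_two hd0.le)
    linarith
  -- The indefinite integral inherits the Hölder exponent `1 / q` of `γ₂`, as `t - s ≤ 1`.
  have hJinc : ∀ s t, 0 ≤ s → s ≤ t → t ≤ 1 →
      ‖J t - J s‖ ≤ (c₁ * c₂ * (3 + 2 * l) + ‖γ₁ 0‖ * c₂) * (t - s) ^ (1 / q) := by
    intro s t hs hst ht
    have hdI : t - s ∈ Icc (0 : ℝ) 1 := ⟨sub_nonneg.2 hst, by linarith⟩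
    have hsI : s ∈ Icc (0 : ℝ) 1 := ⟨hs, hst.trans ht⟩
    have hpow : t - s ≤ (t - s) ^ (1 / q) :=
      Real.self_le_rpow_of_le_one hdI.1 hdI.2 ((div_le_one hq0).2 hq.le)
    have hγ₂' : ‖γ₂ t - γ₂ s‖ ≤ c₂ * (t - s) ^ (1 / q) := by
      refine (H₂ s t hs hst ht).trans (mul_le_mul_of_nonneg_left ?_ hc₂0)
      exact mul_le_of_le_one_right (Real.rpow_nonneg hdI.1 _) (hm₂_le _ hdI)
    have hγ₁' : ‖γ₁ s‖ ≤ ‖γ₁ 0‖ + c₁ := by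
      have h := H₁ 0 s le_rfl hs hsI.2
      rw [sub_zero] at h
      have h' : c₁ * (s ^ (1 / p) * m₁ s) ≤ c₁ :=
        mul_le_of_le_one_right hc₁0 (mul_le_one₀ (Real.rpow_le_one hs hsI.2 (by positivity))
          (hm₁_nonneg s hsI) (hm₁_le s hsI))
      have := norm_le_norm_add_norm_sub' (γ₁ s) (γ₁ 0)
      linarith
    have hI := hinc s t hs hst ht
    have hB := (N.norm_tmulL_le (γ₁ s) (γ₂ t - γ₂ s)).trans
      (mul_le_mul hγ₁' hγ₂' (norm_nonneg _) (by positivity))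
    have h := norm_add_le (J t - J s - N.tmulL (γ₁ s) (γ₂ t - γ₂ s))
      (N.tmulL (γ₁ s) (γ₂ t - γ₂ s))
    rw [sub_add_cancel] at h
    have := mul_le_mul_of_nonneg_left hpow
      (by positivity : 0 ≤ c₁ * c₂ * (2 + 2 * l))
    linarith
  have hrs : ∀ t ∈ Icc (0 : ℝ) 1, rsIntegral N γ₁ γ₂ 0 t = J t - J 0 := fun t ht =>
    (hint 0 t le_rfl ht.2).rsIntegral_eq ht.1
  have hit : ∀ s t, 0 ≤ s → s ≤ t → t ≤ 1 →
      iteratedRSIntegral N γ₁ γ₂ s t = J t - J s - N.tmulL (γ₁ s) (γ₂ t - γ₂ s) :=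
    fun s t hs hst ht => ((hint s t hs ht).sub_const (γ₁ s)).rsIntegral_eq hst
  have hJcont : ContinuousOn J (Icc 0 1) :=
    continuousOn_of_norm_sub_le_rpow (one_div_pos.2 hq0)
      fun s hs t ht hst => hJinc s t hs.1 hst ht.2
  have hvar : pathPVariation q (fun t => rsIntegral N γ₁ γ₂ 0 t) 0 1 ≤
      8 * C₁ * C₂ * (2 + L) + ‖γ₁ 0‖ₑ * C₂ := by
    refine pVariation_le_of_le hq0 fun s t hs hst ht => ?_
    beta_reduce
    rw [hrs t ⟨hs.trans hst, ht⟩, hrs s ⟨hs, hst.trans ht⟩, sub_sub_sub_cancel_right]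
    refine enorm_le_of_norm_le_rpow (sub_nonneg.2 hst) (by positivity) (hJinc s t hs hst ht) ?_
    have e : 8 * C₁ * C₂ * (2 + L) + ‖γ₁ 0‖ₑ * C₂ =
        ENNReal.ofReal (8 * c₁ * c₂ * (2 + l) + ‖γ₁ 0‖ * c₂) := by
      rw [ENNReal.ofReal_add (by positivity) (by positivity), ENNReal.ofReal_mul (by positivity),
        ENNReal.ofReal_mul (by positivity), ENNReal.ofReal_mul (by positivity),
        ENNReal.ofReal_mul (by positivity), ENNReal.ofReal_add (by positivity) hl0, eC₁, eC₂, eL,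
        ofReal_norm, ENNReal.ofReal_ofNat, ENNReal.ofReal_ofNat]
    rw [e]
    refine ENNReal.ofReal_le_ofReal ?_
    have : 0 ≤ c₁ * c₂ := by positivity
    nlinarith [mul_nonneg this hl0]
  refine ⟨fun t ht => ⟨_, hint 0 t le_rfl ht.2⟩,
    (hJcont.sub continuousOn_const).congr hrs, fun h0 => ?_, hvar,
    fun s t hs hst ht => ⟨_, (hint s t hs ht).sub_const (γ₁ s)⟩, ?_, ?_⟩
  · simpa [h0] using hvar
  · have hfst : MapsTo Prod.fst {x : ℝ × ℝ | 0 ≤ x.1 ∧ x.1 ≤ x.2 ∧ x.2 ≤ 1} (Icc 0 1) :=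
      fun x hx => ⟨hx.1, hx.2.1.trans hx.2.2⟩
    have hsnd : MapsTo Prod.snd {x : ℝ × ℝ | 0 ≤ x.1 ∧ x.1 ≤ x.2 ∧ x.2 ≤ 1} (Icc 0 1) :=
      fun x hx => ⟨hx.1.trans hx.2.1, hx.2.2⟩
    refine ContinuousOn.congr ?_ fun x hx => hit x.1 x.2 hx.1 hx.2.1 hx.2.2
    refine ((hJcont.comp continuousOn_snd hsnd).sub (hJcont.comp continuousOn_fst hfst)).sub ?_
    exact (N.tmulL.continuous.comp_continuousOn (hγ₁.comp continuousOn_fst hfst)).clm_apply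
      ((hγ₂.comp continuousOn_snd hsnd).sub (hγ₂.comp continuousOn_fst hfst))
  · refine pVariation_le_of_le one_pos fun s t hs hst ht => ?_
    rw [hit s t hs hst ht]
    refine enorm_le_of_norm_le_rpow (k := c₁ * c₂ * (2 + 2 * l)) (sub_nonneg.2 hst)
      (by norm_num) (by simpa using hinc s t hs hst ht) ?_
    have e : C₁ * C₂ * (15 + 8 * L) = ENNReal.ofReal (c₁ * c₂ * (15 + 8 * l)) := by
      rw [ENNReal.ofReal_mul (by positivity), ENNReal.ofReal_mul hc₁0,
        ENNReal.ofReal_add (by positivity) (by positivity), ENNReal.ofReal_mul (by positivity),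
        eC₁, eC₂, eL, ENNReal.ofReal_ofNat, ENNReal.ofReal_ofNat]
    rw [e]
    refine ENNReal.ofReal_le_ofReal (mul_le_mul_of_nonneg_left ?_ (by positivity))
    linarith
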